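/- Let $N\ge 1$, $L\ge 1$ be integers, $\rho=N/2$, and let either $\theta_0=1$, or $\theta_0=-1$ and $N$ even. Let $V$ be the antidiagonal $N\times N$ matrix $V=\sum_{i=1}^N v_iE_{i\,\bar\imath}$, $\bar\imath=N+1-i$, with all $v_i=1$ if $\theta_0=1$, and with $v_i=1$ for $i\le N/2$, $v_i=-1$ for $i>N/2$ if $\theta_0=-1$. Put $A^t=V^{-1}A^{T}V$. On $\mathbb C^N\otimes\mathbb C^N$ let $P=\sum_{i,j}E_{ij}\otimes E_{ji}$, $Q=P^{t_1}$ (transposition $t$ in the first factor), $\widehat P=\rho I-Q$, $R(\lambda)=\lambda I+\mathrm iP$ and $\bar R(\lambda)=R^{t_1}(-\lambda-\mathrm i\rho)$. On an auxiliary space $0$ and $2L$ sites $1,\dots,2L$, each a copy of $\mathbb C^N$, put $$T_0(\lambda)=R_{0,2L}(\lambda)\bar R_{0,2L-1}(\lambda)\cdots R_{0,2}(\lambda)\bar R_{0,1}(\lambda),\qquad \hat T_{\bar 0}(\lambda)=R_{1,0}(\lambda)\bar R_{2,0}(\lambda)\cdots R_{2L-1,0}(\lambda)\bar R_{2L,0}(\lambda),$$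 and let $t(\lambda)=\mathrm{Tr}_0\,T_0(\lambda)\hat T_{\bar 0}(\lambda)$ be the soliton non-preserving transfer matrix with boundary matrices $\widetilde K^-=\widetilde K^+=I$. Let $\mathcal S_{0i}=P_{0i}+\widehat P_{0i}$ and write $\sum_{i=1}^{2L}\mathcal S_{0i}=\sum_{a,b}E_{ab}\otimes S^{ab}$, with $E_{ab}$ acting in the space $0$ and $S^{ab}$ on the sites. Then: 1. As $\lambda\to\infty$ in $\mathbb C$, $\;T_0(\lambda)\hat T_{\bar 0}(\lambda)=\lambda^{4L}\bigl(I+\frac{\mathrm i}{\lambda}\sum_{i=1}^{2L}\mathcal S_{0i}+O(\lambda^{-2})\bigr)$. 2. For all $\lambda\in\mathbb C$, $\;\bigl[t(\lambda),\sum_{i=1}^{2L}\mathcal S_{0i}\bigr]=0$; that is, $[t(\lambda),S^{ab}]=0$ for all $a,b$. 3. For all $a,b,c,d$, $$[S^{ab},S^{cd}]=\delta_{ad}S^{cb}-\delta_{cb}S^{ad}-v_cv_d\bigl(\delta_{a\bar c}S^{\bar d b}-\delta_{b\bar d}S^{a\bar c}\bigr),\qquad S^{ab}+v_av_b\,S^{\bar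 b\bar a}=2LN\,\delta_{ab}I,$$ the relations of the first-level generators of the twisted Yangian, up to the central shift in the second one. 4. Let $\mathfrak g=\{X\in M_N(\mathbb C): X^{T}V+VX=0\}=\{X: X^t=-X\}$. The diagonal action $\varphi(X)=\sum_{i=1}^{2L}X_i$ on the sites is an injective Lie algebra homomorphism on $\mathfrak g$. The matrices $F^{ab}=E_{ba}-(E_{ba})^t$ lie in $\mathfrak g$ and span it, and $S^{ab}=\varphi(F^{ab})+LN\,\delta_{ab}I$. Moreover $\mathfrak g\cong so(N)$ if $\theta_0=1$, and $\mathfrak g\cong sp(N)$ (the symplectic Lie algebra of $N\times N$ matrices) if $\theta_0=-1$. So, up to a multiple of the identity, the $S^{ab}$ realise $so(N)$, respectively $sp(N)$. -/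

import Mathlib

/-! The Lie bracket of an associative algebra is the commutator. -/
attribute [local instance 100] LieRing.ofAssociativeRing

namespace SNPChain

/-- Operators on the `n`-fold tensor power of `ℂ^N`, written in the tensor basis
`e_{f 0} ⊗ ⋯ ⊗ e_{f (n-1)}` indexed by `f : Fin n → Fin N`. -/
abbrev Op (n N : ℕ) : Type := Matrix (Fin n → Fin N) (Fin n → Fin N) ℂ

/-- The entries of the antidiagonal matrix `V`: all equal to `1` for `θ₀ = 1`, and
`1, …, 1, -1, …, -1` (each `N / 2` times) for `θ₀ = -1` and `N` even. -/
def antidiagEntry (N : ℕ) (θ₀ : ℂ) (i : Fin N) : ℂ :=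
  if 2 * (i : ℕ) < N then 1 else θ₀

/-- The antidiagonal matrix `V`; one has `V ^ 2 = θ₀`. -/
def V (N : ℕ) (θ₀ : ℂ) : Matrix (Fin N) (Fin N) ℂ :=
  Matrix.of fun i j => if j = i.rev then antidiagEntry N θ₀ i else 0

/-- The transposition `A^t = V⁻¹ Aᵀ V`. -/
noncomputable def transp (N : ℕ) (θ₀ : ℂ) (A : Matrix (Fin N) (Fin N) ℂ) :
    Matrix (Fin N) (Fin N) ℂ :=
  (V N θ₀)⁻¹ * A.transpose * V N θ₀

/-- The transposition `t` in the first factor of `ℂ^N ⊗ ℂ^N`. -/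
noncomputable def transp₁ (N : ℕ) (θ₀ : ℂ)
    (M : Matrix (Fin N × Fin N) (Fin N × Fin N) ℂ) :
    Matrix (Fin N × Fin N) (Fin N × Fin N) ℂ :=
  Matrix.kronecker (V N θ₀)⁻¹ 1 *
    (Matrix.of fun p q => M (q.1, p.2) (p.1, q.2)) * Matrix.kronecker (V N θ₀) 1

/-- The permutation operator `P = ∑ E_ij ⊗ E_ji`. -/
def permOp (N : ℕ) : Matrix (Fin N × Fin N) (Fin N × Fin N) ℂ :=
  ∑ i : Fin N, ∑ j : Fin N, Matrix.kronecker (Matrix.single i j 1) (Matrix.single j i 1)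

/-- `ρ = N / 2`. -/
noncomputable def rho (N : ℕ) : ℂ := (N : ℂ) / 2

/-- The operator `Q`, the partial transpose of `P`. -/
noncomputable def Q (N : ℕ) (θ₀ : ℂ) : Matrix (Fin N × Fin N) (Fin N × Fin N) ℂ :=
  transp₁ N θ₀ (permOp N)

/-- `P̂ = ρ I - Q`. -/
noncomputable def permHat (N : ℕ) (θ₀ : ℂ) : Matrix (Fin N × Fin N) (Fin N × Fin N) ℂ :=
  rho N • (1 : Matrix (Fin N × Fin N) (Fin N × Fin N) ℂ) - Q N θ₀

/-- The soliton-soliton matrix `R(lam) = lam I + i P`. -/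
noncomputable def R (N : ℕ) (lam : ℂ) : Matrix (Fin N × Fin N) (Fin N × Fin N) ℂ :=
  lam • (1 : Matrix (Fin N × Fin N) (Fin N × Fin N) ℂ) + Complex.I • permOp N

/-- The soliton-antisoliton matrix `R̄₁₂(lam) = R₁₂^{t₁}(-lam - i ρ)`. -/
noncomputable def Rbar (N : ℕ) (θ₀ : ℂ) (lam : ℂ) :
    Matrix (Fin N × Fin N) (Fin N × Fin N) ℂ :=
  transp₁ N θ₀ (R N (-lam - Complex.I * rho N))

/-- The operator `A_i`: `A` acting in the tensor factor `i`, the identity elsewhere. -/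
def onSite {n N : ℕ} (i : Fin n) (A : Matrix (Fin N) (Fin N) ℂ) : Op n N :=
  Matrix.of fun f g => if ∀ k, k ≠ i → f k = g k then A (f i) (g i) else 0

/-- The operator `M_ij` (for `i ≠ j`): the first factor of `M` acts in the tensor factor `i`,
the second one in the tensor factor `j`, and the identity acts elsewhere. -/
def onSites {n N : ℕ} (i j : Fin n) (M : Matrix (Fin N × Fin N) (Fin N × Fin N) ℂ) : Op n N :=
  Matrix.of fun f g =>
    if ∀ k, k ≠ i → k ≠ j → f k = g k then M (f i, f j) (g i, g j) else 0

/-- The trace over the tensor factor `0`. -/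
def trace₀ {n N : ℕ} (M : Op (n + 1) N) : Op n N :=
  Matrix.of fun x y =>
    ∑ k : Fin N, M (Fin.cons k x : Fin (n + 1) → Fin N) (Fin.cons k y : Fin (n + 1) → Fin N)

/-- The operator `M^{ab}` in `M = ∑ E_ab ⊗ M^{ab}`, with `E_ab` in the tensor factor `0`. -/
def component₀ {n N : ℕ} (M : Op (n + 1) N) (a b : Fin N) : Op n N :=
  Matrix.of fun x y => M (Fin.cons a x : Fin (n + 1) → Fin N) (Fin.cons b y : Fin (n + 1) → Fin N)

/-- The operator `I ⊗ M`, with the identity in the tensor factor `0`. -/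
def extend₀ {n N : ℕ} (M : Op n N) : Op (n + 1) N :=
  Matrix.of fun f g => if f 0 = g 0 then M (Fin.tail f) (Fin.tail g) else 0

/-! The auxiliary space is the tensor factor `0` and the sites of the chain are the tensor factors
`1, …, 2L`, so that `j : Fin (2 * L)` stands for the site `j.succ`. -/

/-- `T₀ = R_{0,2L} R̄_{0,2L-1} ⋯ R_{0,2} R̄_{0,1}`. -/
noncomputable def T (N L : ℕ) (θ₀ lam : ℂ) : Op (2 * L + 1) N :=
  ((List.finRange (2 * L)).reverse.map fun j =>
    onSites 0 j.succ (if Even (j.succ : ℕ) then R N lam else Rbar N θ₀ lam)).prod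

/-- The second monodromy factor `R_{1,0} R̄_{2,0} ⋯ R_{2L-1,0} R̄_{2L,0}`. -/
noncomputable def That (N L : ℕ) (θ₀ lam : ℂ) : Op (2 * L + 1) N :=
  ((List.finRange (2 * L)).map fun j =>
    onSites j.succ 0 (if Even (j.succ : ℕ) then Rbar N θ₀ lam else R N lam)).prod

/-- The monodromy matrix for the boundary matrix `Km` (the value of `K̃⁻` at `lam`). -/
noncomputable def monodromy (N L : ℕ) (θ₀ : ℂ) (Km : Matrix (Fin N) (Fin N) ℂ) (lam : ℂ) :
    Op (2 * L + 1) N :=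
  T N L θ₀ lam * onSite 0 Km * That N L θ₀ lam

/-- The transfer matrix for the boundary matrices `Kp`, `Km`
(the values of `K̃⁺` and `K̃⁻` at `lam`). -/
noncomputable def transfer (N L : ℕ) (θ₀ : ℂ) (Kp Km : Matrix (Fin N) (Fin N) ℂ) (lam : ℂ) :
    Op (2 * L) N :=
  trace₀ (onSite 0 Kp * monodromy N L θ₀ Km lam)

/-- The operator `S_{0i}` at the site `i = j.succ`, for a constant boundary matrix `Km`. -/
noncomputable def S (N L : ℕ) (θ₀ : ℂ) (Km : Matrix (Fin N) (Fin N) ℂ) (j : Fin (2 * L)) :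
    Op (2 * L + 1) N :=
  if Even (j.succ : ℕ) then
    onSites 0 j.succ (permOp N) * onSite 0 Km + onSite 0 Km * onSites 0 j.succ (permHat N θ₀)
  else
    onSite 0 Km * onSites 0 j.succ (permOp N) + onSites 0 j.succ (permHat N θ₀) * onSite 0 Km

/-- The sum of the `S_{0i}` over all sites, for trivial boundary matrix. -/
noncomputable def Stot (N L : ℕ) (θ₀ : ℂ) : Op (2 * L + 1) N :=
  ∑ j : Fin (2 * L), S N L θ₀ 1 j

/-- The generator `S^{ab}`, the coefficient of `E_ab` in the sum of the `S_{0i}`. -/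
noncomputable def gen (N L : ℕ) (θ₀ : ℂ) (a b : Fin N) : Op (2 * L) N :=
  component₀ (Stot N L θ₀) a b

/-- The Lie algebra of the matrices `X` with `Xᵀ V + V X = 0`, that is, `X^t = -X`. -/
noncomputable abbrev lieV (N : ℕ) (θ₀ : ℂ) : LieSubalgebra ℂ (Matrix (Fin N) (Fin N) ℂ) :=
  skewAdjointMatricesLieSubalgebra (V N θ₀)

end SNPChain

/-! The symmetry comes from the individual factors. The permutation `P` commutes with `X ⊗ 1 + 1 ⊗
X` for every `X`. The operator `Q` is the rank-one matrix `v vᵀ`, where `v` lists the entries of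
`V`; for `X` in the Lie algebra of `V` the relations `X V + V Xᵀ = 0` and `Xᵀ V + V X = 0` say that
`X ⊗ 1 + 1 ⊗ X` kills `v` from both sides, so it commutes with `Q` as well (`Q_commute`). Hence
every `R` and `R̄`, and so the whole monodromy matrix, commutes with the diagonal action on all `2L
+ 1` factors. Under the trace over the auxiliary factor the term acting there drops out, leaving
`t(λ)` commuting with the diagonal action on the sites (`trace₀_commute_diagonal`). Neither a
Yang–Baxter nor a reflection equation is needed.

The bridge to the generators is `gen_eq_diagonal`: `S^{ab}` is the diagonal action of `E_ba -
(E_ba)^t` plus a central term. Since `A ↦ A^t` is an anti-involution, the relations among the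
`S^{ab}` reduce to commutators of matrix units through `lie_skew`.

For the asymptotics, `R̄(λ) = -(λ + i P̂)` (`Rbar_eq`), so the monodromy is a product of `4L`
factors `±(λ + i A)`; expanding in `1/λ` gives the sum of the `A` as first coefficient. Finally, `V`
is congruent over `ℂ` to the identity when symmetric, and is a reindexing of the standard `J` when
antisymmetric. -/

namespace SNPChain

/-! ### Operators acting in one or two tensor factors -/

section Sites

variable {n N : ℕ}

theorem sum_eq_off {M : Type*} [AddCommMonoid M] (i : Fin n) (f : Fin n → Fin N)
    (F : (Fin n → Fin N) → M) :
    (∑ h : Fin n → Fin N, if ∀ k, k ≠ i → f k = h k then F h else 0) =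
      ∑ c : Fin N, F (Function.update f i c) := by
  rw [← Finset.sum_filter]
  symm
  refine Finset.sum_nbij' (fun c => Function.update f i c) (fun h => h i) ?_ ?_ ?_ ?_ ?_
  · intro c _
    simp only [Finset.mem_filter, Finset.mem_univ, true_and]
    intro k hk
    simp [hk]
  · simp
  · simp
  · intro h hh
    simp only [Finset.mem_filter, Finset.mem_univ, true_and] at hh
    funext k
    by_cases hk : k = i
    · subst hk; simp
    · simp [hk, hh k hk]
  · simp

/-- `onSite i` as an algebra homomorphism. -/
def onSiteHom (i : Fin n) : Matrix (Fin N) (Fin N) ℂ →ₐ[ℂ] Op n N :=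
  AlgHom.ofLinearMap
    { toFun := onSite i
      map_add' := fun A B => by
        ext f g
        by_cases h : ∀ k, k ≠ i → f k = g k
        · simp only [onSite, Matrix.of_apply, Matrix.add_apply, if_pos h]
        · simp only [onSite, Matrix.of_apply, Matrix.add_apply, if_neg h, add_zero]
      map_smul' := fun c A => by
        ext f g
        by_cases h : ∀ k, k ≠ i → f k = g k <;> simp [onSite, h] }
    (by
      ext f g
      simp only [LinearMap.coe_mk, AddHom.coe_mk, onSite, Matrix.of_apply, Matrix.one_apply]
      by_cases h : f = g
      · simp [h]
      · simp only [h, if_false, ite_eq_right_iff]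
        intro h1 h2
        exact (h (funext fun k => if hk : k = i then hk ▸ h2 else h1 k hk)).elim)
    (fun A B => by
      ext f g
      simp only [LinearMap.coe_mk, AddHom.coe_mk, onSite, Matrix.of_apply, Matrix.mul_apply,
        ite_mul, zero_mul]
      rw [sum_eq_off i f (fun h => A (f i) (h i) *
        if ∀ k, k ≠ i → h k = g k then B (h i) (g i) else 0)]
      have key : ∀ c, (∀ k, k ≠ i → Function.update f i c k = g k) ↔ ∀ k, k ≠ i → f k = g k :=
        fun c => forall₂_congr fun k hk => by simp [hk]
      simp only [key, Function.update_self]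
      split_ifs <;> simp)

@[simp]
theorem onSiteHom_apply (i : Fin n) (A : Matrix (Fin N) (Fin N) ℂ) :
    onSiteHom i A = onSite i A := rfl

theorem onSite_one (i : Fin n) : onSite i (1 : Matrix (Fin N) (Fin N) ℂ) = 1 :=
  map_one (onSiteHom i)

/-- `onSites i j` as a linear map. -/
def onSitesHom (i j : Fin n) : Matrix (Fin N × Fin N) (Fin N × Fin N) ℂ →ₗ[ℂ] Op n N where
  toFun := onSites i j
  map_add' A B := by
    ext f g
    by_cases h : ∀ k, k ≠ i → k ≠ j → f k = g k
    · simp only [onSites, Matrix.of_apply, Matrix.add_apply, if_pos h]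
    · simp only [onSites, Matrix.of_apply, Matrix.add_apply, if_neg h, add_zero]
  map_smul' c A := by
    ext f g
    by_cases h : ∀ k, k ≠ i → k ≠ j → f k = g k
    · simp only [onSites, Matrix.of_apply, Matrix.smul_apply, if_pos h, RingHom.id_apply]
    · simp only [onSites, Matrix.of_apply, Matrix.smul_apply, if_neg h, smul_zero]

@[simp]
theorem onSitesHom_apply (i j : Fin n) (A : Matrix (Fin N × Fin N) (Fin N × Fin N) ℂ) :
    onSitesHom i j A = onSites i j A := rfl

/-- Together with `kronecker_induction`, this reduces facts about two-site operators to one-site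
ones. -/
theorem onSites_kronecker {i j : Fin n} (hij : i ≠ j) (A B : Matrix (Fin N) (Fin N) ℂ) :
    onSites i j (Matrix.kronecker A B) = onSite i A * onSite j B := by
  ext f g
  simp only [onSites, onSite, Matrix.of_apply, Matrix.mul_apply, ite_mul, zero_mul]
  rw [sum_eq_off i f (fun h => A (f i) (h i) *
    if ∀ k, k ≠ j → h k = g k then B (h j) (g j) else 0)]
  simp only [Function.update_self, Function.update_of_ne hij.symm]
  have key : ∀ c, (∀ k, k ≠ j → Function.update f i c k = g k) ↔
      (c = g i ∧ ∀ k, k ≠ i → k ≠ j → f k = g k) := by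
    intro c
    constructor
    · intro h
      refine ⟨by simpa using h i hij, fun k hk hk' => by simpa [hk] using h k hk'⟩
    · rintro ⟨rfl, h⟩ k hk
      by_cases hk' : k = i
      · subst hk'; simp
      · simpa [hk'] using h k hk' hk
  simp only [key]
  by_cases h : ∀ k, k ≠ i → k ≠ j → f k = g k
  · simp only [if_pos h, and_iff_left h, mul_ite, mul_zero]
    simp [Matrix.kroneckerMap_apply]
  · simp only [h, and_false, if_false, mul_zero, Finset.sum_const_zero]

theorem onSites_swap (i j : Fin n) (M : Matrix (Fin N × Fin N) (Fin N × Fin N) ℂ) :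
    onSites j i M = onSites i j (M.submatrix Prod.swap Prod.swap) := by
  ext f g
  have : (∀ k, k ≠ j → k ≠ i → f k = g k) ↔ (∀ k, k ≠ i → k ≠ j → f k = g k) :=
    forall_congr' fun k => ⟨fun h a b => h b a, fun h a b => h b a⟩
  simp only [onSites, Matrix.of_apply, this, Matrix.submatrix_apply, Prod.swap_prod_mk]

/-- Either product is a Kronecker product placed on the two sites; exchanging the sites exchanges
the factors, and scalar entries commute. -/
theorem onSite_commute {i j : Fin n} (hij : i ≠ j) (A B : Matrix (Fin N) (Fin N) ℂ) :
    Commute (onSite i A) (onSite j B) := by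
  rw [Commute, SemiconjBy, ← onSites_kronecker hij, ← onSites_kronecker hij.symm,
    onSites_swap i j]
  congr 1
  ext p q
  simp [Matrix.kroneckerMap_apply, mul_comm]

/-- Matrix units on a product index type are Kronecker products of matrix units. -/
theorem kronecker_induction
    {C : Matrix (Fin N × Fin N) (Fin N × Fin N) ℂ → Prop}
    (M : Matrix (Fin N × Fin N) (Fin N × Fin N) ℂ) (h0 : C 0)
    (hadd : ∀ A B, C A → C B → C (A + B)) (hk : ∀ A B, C (Matrix.kronecker A B)) : C M := by
  refine Matrix.induction_on' M h0 hadd fun p q c => ?_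
  have : Matrix.single p q c =
      Matrix.kronecker (Matrix.single p.1 q.1 c) (Matrix.single p.2 q.2 1) := by
    rw [Matrix.kronecker, Matrix.kroneckerMap_single_single] <;> simp
  rw [this]
  exact hk _ _

theorem onSites_mul {i j : Fin n} (hij : i ≠ j)
    (M M' : Matrix (Fin N × Fin N) (Fin N × Fin N) ℂ) :
    onSites i j (M * M') = onSites i j M * onSites i j M' := by
  simp only [← onSitesHom_apply]
  induction M using kronecker_induction with
  | h0 => simp only [zero_mul, map_zero]
  | hadd A B hA hB => simp only [add_mul, map_add, hA, hB]
  | hk A B =>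
    induction M' using kronecker_induction with
    | h0 => simp only [mul_zero, map_zero]
    | hadd C D hC hD => simp only [mul_add, map_add, hC, hD]
    | hk C D =>
      have h1 : Matrix.kronecker A B * Matrix.kronecker C D = Matrix.kronecker (A * C) (B * D) :=
        (Matrix.mul_kronecker_mul A C B D).symm
      rw [h1]
      simp only [onSitesHom_apply, onSites_kronecker hij, ← onSiteHom_apply, map_mul]
      simp only [onSiteHom_apply]
      rw [mul_assoc, mul_assoc, ← mul_assoc (onSite i C), (onSite_commute hij C B).eq, mul_assoc]

theorem onSites_commute_onSite {i j k : Fin n} (hij : i ≠ j) (hi : k ≠ i) (hj : k ≠ j)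
    (M : Matrix (Fin N × Fin N) (Fin N × Fin N) ℂ) (X : Matrix (Fin N) (Fin N) ℂ) :
    Commute (onSites i j M) (onSite k X) := by
  rw [← onSitesHom_apply]
  induction M using kronecker_induction with
  | h0 => rw [map_zero]; exact Commute.zero_left _
  | hadd A B hA hB => rw [map_add]; exact hA.add_left hB
  | hk A B =>
    rw [onSitesHom_apply, onSites_kronecker hij]
    exact (onSite_commute hi.symm A X).mul_left (onSite_commute hj.symm B X)

theorem onSites_one {i j : Fin n} (hij : i ≠ j) :
    onSites i j (1 : Matrix (Fin N × Fin N) (Fin N × Fin N) ℂ) = 1 := by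
  have : (1 : Matrix (Fin N × Fin N) (Fin N × Fin N) ℂ) = Matrix.kronecker 1 1 := by
    simp [Matrix.kronecker]
  rw [this, onSites_kronecker hij, onSite_one, onSite_one, one_mul]

/-- The diagonal action of matrices on all tensor factors. -/
def diagonal : Matrix (Fin N) (Fin N) ℂ →ₗ[ℂ] Op n N :=
  ∑ j : Fin n, (onSiteHom j).toLinearMap

theorem diagonal_apply (X : Matrix (Fin N) (Fin N) ℂ) :
    (diagonal X : Op n N) = ∑ j, onSite j X := by
  simp [diagonal, LinearMap.sum_apply]

/-- Actions at different sites commute, so only the equal-site terms of the double sum survive. -/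
theorem diagonal_lie (X Y : Matrix (Fin N) (Fin N) ℂ) :
    (diagonal ⁅X, Y⁆ : Op n N) = ⁅(diagonal X : Op n N), (diagonal Y : Op n N)⁆ := by
  have h : ∀ i j : Fin n, onSite i X * onSite j Y - onSite j Y * onSite i X =
      if i = j then onSite i (X * Y - Y * X) else 0 := by
    intro i j
    split_ifs with hij
    · subst hij
      simp only [← onSiteHom_apply, map_sub, map_mul]
    · rw [(onSite_commute hij X Y).eq, sub_self]
  simp only [diagonal_apply, Ring.lie_def, Finset.sum_mul_sum]
  rw [Finset.sum_comm (f := fun i j => onSite i Y * onSite j X), ← Finset.sum_sub_distrib]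
  simp only [← Finset.sum_sub_distrib, h, Finset.sum_ite_eq, Finset.mem_univ, if_true]

theorem diagonal_one : (diagonal (1 : Matrix (Fin N) (Fin N) ℂ) : Op n N) = (n : ℂ) • 1 := by
  simp [diagonal_apply, onSite_one, Nat.cast_smul_eq_nsmul]

theorem diagonal_injective (hn : n ≠ 0) :
    Function.Injective (diagonal : Matrix (Fin N) (Fin N) ℂ →ₗ[ℂ] Op n N) := by
  rw [injective_iff_map_eq_zero]
  intro X hX
  rw [diagonal_apply] at hX
  have : NeZero n := ⟨hn⟩
  ext a b
  -- Test between the constant configuration `a` and the one with `b` at site `0`. If `a ≠ b` only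
  -- site `0` contributes, giving `X a b`; if `a = b` every site does, giving `n * X a a`.
  have h := congrFun (congrFun hX (fun _ => a)) (Function.update (fun _ => a) 0 b)
  rw [Matrix.sum_apply] at h
  by_cases hab : a = b
  · subst hab
    simpa [onSite, hn] using h
  · rw [Finset.sum_eq_single 0] at h
    · have h' : ∀ k : Fin n, k ≠ 0 → a = Function.update (fun _ => a) 0 b k := by
        intro k hk; simp [hk]
      simp only [onSite, Matrix.of_apply] at h
      rw [if_pos h', Function.update_self] at h
      exact h
    · intro j _ hj
      simp only [onSite, Matrix.of_apply]
      rw [if_neg]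
      intro h'
      exact hab (by simpa using h' 0 hj.symm)
    · simp

/-- Split off the terms at `i` and `j`: they form the two-site operator in `h`, while all other
sites commute with `M` by locality. -/
theorem onSites_commute_diagonal {i j : Fin n} (hij : i ≠ j)
    {M : Matrix (Fin N × Fin N) (Fin N × Fin N) ℂ} {X : Matrix (Fin N) (Fin N) ℂ}
    (h : Commute M (Matrix.kronecker X 1 + Matrix.kronecker 1 X)) :
    Commute (onSites i j M) (diagonal X) := by
  have h2 : onSite i X + onSite j X =
      onSites i j (Matrix.kronecker X 1 + Matrix.kronecker 1 X) := by
    rw [← onSitesHom_apply, map_add, onSitesHom_apply, onSitesHom_apply,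
      onSites_kronecker hij, onSites_kronecker hij, onSite_one, onSite_one, mul_one, one_mul]
  rw [diagonal_apply, ← Finset.add_sum_erase _ _ (Finset.mem_univ i),
    ← Finset.add_sum_erase (Finset.univ.erase i) _ (Finset.mem_erase.2 ⟨hij.symm, Finset.mem_univ j⟩),
    ← add_assoc, h2]
  refine Commute.add_right ?_ (Commute.sum_right _ _ _ fun k hk => ?_)
  · rw [Commute, SemiconjBy, ← onSites_mul hij, ← onSites_mul hij, h.eq]
  · simp only [Finset.mem_erase] at hk
    exact onSites_commute_onSite hij hk.2.1 hk.1 M X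

end Sites

/-! ### Components in the auxiliary space -/

section Components

variable {n N : ℕ}

theorem component₀_mul (A B : Op (n + 1) N) (a b : Fin N) :
    component₀ (A * B) a b = ∑ c, component₀ A a c * component₀ B c b := by
  ext x y
  simp only [component₀, Matrix.of_apply, Matrix.mul_apply, Matrix.sum_apply]
  rw [← (Fin.consEquiv fun _ => Fin N).sum_comp, Fintype.sum_prod_type]
  rfl

theorem component₀_add (A B : Op (n + 1) N) (a b : Fin N) :
    component₀ (A + B) a b = component₀ A a b + component₀ B a b := rfl

theorem component₀_sub (A B : Op (n + 1) N) (a b : Fin N) :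
    component₀ (A - B) a b = component₀ A a b - component₀ B a b := rfl

theorem component₀_sum {ι : Type*} (s : Finset ι) (A : ι → Op (n + 1) N) (a b : Fin N) :
    component₀ (∑ i ∈ s, A i) a b = ∑ i ∈ s, component₀ (A i) a b := by
  ext x y
  simp [component₀, Matrix.sum_apply]

theorem component₀_ext {A B : Op (n + 1) N} (h : ∀ a b, component₀ A a b = component₀ B a b) :
    A = B := by
  ext f g
  have := congrFun (congrFun (h (f 0) (g 0)) (Fin.tail f)) (Fin.tail g)
  simpa [component₀] using this

theorem component₀_onSites (j : Fin n) (M : Matrix (Fin N × Fin N) (Fin N × Fin N) ℂ)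
    (a b : Fin N) :
    component₀ (onSites 0 j.succ M) a b = onSite j (Matrix.of fun x y => M (a, x) (b, y)) := by
  ext x y
  simp [component₀, onSites, onSite, Fin.forall_fin_succ]

theorem component₀_onSite_zero (X : Matrix (Fin N) (Fin N) ℂ) (a b : Fin N) :
    component₀ (onSite (0 : Fin (n + 1)) X) a b = X a b • 1 := by
  ext x y
  simp [component₀, onSite, Fin.forall_fin_succ, Matrix.one_apply, funext_iff]

theorem component₀_onSite_succ (j : Fin n) (X : Matrix (Fin N) (Fin N) ℂ) (a b : Fin N) :
    component₀ (onSite j.succ X) a b = if a = b then onSite j X else 0 := by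
  ext x y
  by_cases h : a = b <;>
    simp [component₀, onSite, Fin.forall_fin_succ, h, (Fin.succ_ne_zero j).symm]

theorem component₀_diagonal (X : Matrix (Fin N) (Fin N) ℂ) (a b : Fin N) :
    component₀ (diagonal X : Op (n + 1) N) a b =
      X a b • 1 + if a = b then diagonal X else 0 := by
  rw [diagonal_apply, Fin.sum_univ_succ, component₀_add, component₀_onSite_zero, component₀_sum,
    diagonal_apply]
  simp only [component₀_onSite_succ]
  split_ifs <;> simp

theorem component₀_extend₀ (M : Op n N) (a b : Fin N) :
    component₀ (extend₀ M) a b = if a = b then M else 0 := by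
  ext x y
  by_cases h : a = b <;> simp [component₀, extend₀, h]

theorem trace₀_eq (M : Op (n + 1) N) : trace₀ M = ∑ a, component₀ M a a := by
  ext x y
  simp [component₀, trace₀, Matrix.sum_apply]

theorem trace₀_commute_diagonal {M : Op (n + 1) N} {X : Matrix (Fin N) (Fin N) ℂ}
    (h : Commute M (diagonal X)) : Commute (trace₀ M) (diagonal X) := by
  have h1 : ∑ a, component₀ (M * diagonal X) a a = ∑ a, component₀ (diagonal X * M) a a := by
    rw [h.eq]
  simp only [component₀_mul, component₀_diagonal, mul_add, add_mul, Finset.sum_add_distrib,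
    mul_ite, ite_mul, mul_zero, zero_mul, Finset.sum_ite_eq, Finset.sum_ite_eq', Finset.mem_univ,
    if_true, mul_smul_comm, smul_mul_assoc, mul_one, one_mul] at h1
  -- The action on the auxiliary factor has scalar components, so its two contributions agree after
  -- exchanging summation indices (cyclicity of the partial trace).
  rw [Finset.sum_comm, add_left_cancel_iff] at h1
  rw [Commute, SemiconjBy, trace₀_eq, Finset.sum_mul, Finset.mul_sum, h1]

theorem lie_extend₀_eq_zero {M : Op n N} {A : Op (n + 1) N}
    (h : ∀ a b, ⁅M, component₀ A a b⁆ = 0) : ⁅extend₀ M, A⁆ = 0 := by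
  refine component₀_ext fun a b => ?_
  rw [Ring.lie_def, component₀_sub, component₀_mul, component₀_mul]
  have h0 : component₀ (0 : Op (n + 1) N) a b = 0 := rfl
  simpa [component₀_extend₀, Ring.lie_def, h0] using h a b

end Components

end SNPChain

namespace SNPChain

/-! ### The antidiagonal matrix and its transposition -/

section Antidiagonal

variable {N : ℕ} {θ₀ : ℂ}

theorem sq_eq_one_of_sign (hθ : θ₀ = 1 ∨ (θ₀ = -1 ∧ Even N)) : θ₀ * θ₀ = 1 := by
  rcases hθ with rfl | ⟨rfl, _⟩ <;> norm_num

theorem antidiagEntry_mul_self (hθ : θ₀ = 1 ∨ (θ₀ = -1 ∧ Even N)) (a : Fin N) :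
    antidiagEntry N θ₀ a * antidiagEntry N θ₀ a = 1 := by
  unfold antidiagEntry
  split_ifs
  · norm_num
  · exact sq_eq_one_of_sign hθ

/-- For `θ₀ = -1`, evenness of `N` rules out a middle index, so reversal always exchanges the two
halves. -/
theorem antidiagEntry_rev (hθ : θ₀ = 1 ∨ (θ₀ = -1 ∧ Even N)) (a : Fin N) :
    antidiagEntry N θ₀ a.rev = θ₀ * antidiagEntry N θ₀ a := by
  rcases hθ with rfl | ⟨rfl, k, hk⟩
  · simp [antidiagEntry]
  · have ha := a.isLt
    unfold antidiagEntry
    simp only [Fin.val_rev]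
    by_cases h : 2 * (a : ℕ) < N
    · rw [if_neg (by omega), if_pos h]; norm_num
    · rw [if_pos (by omega), if_neg h]; norm_num

theorem V_apply (a b : Fin N) : V N θ₀ a b = if b = a.rev then antidiagEntry N θ₀ a else 0 := rfl

theorem V_transpose (hθ : θ₀ = 1 ∨ (θ₀ = -1 ∧ Even N)) :
    (V N θ₀).transpose = θ₀ • V N θ₀ := by
  ext a b
  simp only [Matrix.transpose_apply, Matrix.smul_apply, V_apply, smul_eq_mul]
  by_cases h : b = a.rev
  · subst h
    rw [if_pos (Fin.rev_rev a).symm, if_pos rfl, antidiagEntry_rev hθ]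
  · rw [if_neg h, if_neg (fun h' => h (by rw [h', Fin.rev_rev])), mul_zero]

theorem V_mul_apply (A : Matrix (Fin N) (Fin N) ℂ) (a b : Fin N) :
    (V N θ₀ * A) a b = antidiagEntry N θ₀ a * A a.rev b := by
  rw [Matrix.mul_apply, Finset.sum_eq_single a.rev]
  · rw [V_apply, if_pos rfl]
  · intro c _ hc
    rw [V_apply, if_neg hc, zero_mul]
  · simp

theorem mul_V_apply (A : Matrix (Fin N) (Fin N) ℂ) (a b : Fin N) :
    (A * V N θ₀) a b = A a b.rev * antidiagEntry N θ₀ b.rev := by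
  rw [Matrix.mul_apply, Finset.sum_eq_single b.rev]
  · rw [V_apply, if_pos (Fin.rev_rev b).symm]
  · intro c _ hc
    rw [V_apply, if_neg (fun h => hc (by rw [h, Fin.rev_rev])), mul_zero]
  · simp

theorem V_mul_V (hθ : θ₀ = 1 ∨ (θ₀ = -1 ∧ Even N)) : V N θ₀ * V N θ₀ = θ₀ • 1 := by
  ext a b
  rw [V_mul_apply, V_apply, Fin.rev_rev, antidiagEntry_rev hθ, Matrix.smul_apply, Matrix.one_apply]
  by_cases h : a = b
  · rw [if_pos h.symm, if_pos h, mul_left_comm, antidiagEntry_mul_self hθ, smul_eq_mul]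
  · rw [if_neg (Ne.symm h), if_neg h, mul_zero, smul_zero]

theorem V_inv (hθ : θ₀ = 1 ∨ (θ₀ = -1 ∧ Even N)) : (V N θ₀)⁻¹ = θ₀ • V N θ₀ := by
  refine Matrix.inv_eq_right_inv ?_
  rw [Matrix.mul_smul, V_mul_V hθ, smul_smul, sq_eq_one_of_sign hθ, one_smul]

theorem V_mul_inv (hθ : θ₀ = 1 ∨ (θ₀ = -1 ∧ Even N)) : V N θ₀ * (V N θ₀)⁻¹ = 1 := by
  rw [V_inv hθ, Matrix.mul_smul, V_mul_V hθ, smul_smul, sq_eq_one_of_sign hθ, one_smul]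

theorem V_inv_mul (hθ : θ₀ = 1 ∨ (θ₀ = -1 ∧ Even N)) : (V N θ₀)⁻¹ * V N θ₀ = 1 := by
  rw [V_inv hθ, Matrix.smul_mul, V_mul_V hθ, smul_smul, sq_eq_one_of_sign hθ, one_smul]

theorem transp_mul (hθ : θ₀ = 1 ∨ (θ₀ = -1 ∧ Even N)) (A B : Matrix (Fin N) (Fin N) ℂ) :
    transp N θ₀ (A * B) = transp N θ₀ B * transp N θ₀ A := by
  simp only [transp, Matrix.transpose_mul, Matrix.mul_assoc]
  rw [← Matrix.mul_assoc (V N θ₀) (V N θ₀)⁻¹, V_mul_inv hθ, Matrix.one_mul]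

theorem transp_transp (hθ : θ₀ = 1 ∨ (θ₀ = -1 ∧ Even N)) (A : Matrix (Fin N) (Fin N) ℂ) :
    transp N θ₀ (transp N θ₀ A) = A := by
  have h := sq_eq_one_of_sign hθ
  have hV := V_mul_V hθ
  simp only [transp, V_inv hθ, Matrix.transpose_mul, Matrix.transpose_smul, V_transpose hθ,
    Matrix.transpose_transpose, Matrix.smul_mul, Matrix.mul_smul, smul_smul, h, one_smul]
  rw [← Matrix.mul_assoc, ← Matrix.mul_assoc, hV, Matrix.mul_assoc, hV]
  simp [smul_smul, h]

theorem transp_single (hθ : θ₀ = 1 ∨ (θ₀ = -1 ∧ Even N)) (a b : Fin N) :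
    transp N θ₀ (Matrix.single b a 1) =
      (antidiagEntry N θ₀ a * antidiagEntry N θ₀ b) • Matrix.single a.rev b.rev 1 := by
  have h1 : V N θ₀ * Matrix.single a b 1 * V N θ₀ =
      (antidiagEntry N θ₀ a.rev * antidiagEntry N θ₀ b) • Matrix.single a.rev b.rev 1 := by
    ext x y
    rw [mul_V_apply, V_mul_apply, Matrix.smul_apply, Matrix.single_apply, Matrix.single_apply]
    have hx : a = x.rev ↔ a.rev = x := Fin.rev_eq_iff.symm
    have hy : b = y.rev ↔ b.rev = y := Fin.rev_eq_iff.symm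
    simp only [hx, hy]
    split_ifs with h
    · rw [← h.1, ← h.2, Fin.rev_rev, smul_eq_mul, mul_one, mul_one]
    · simp
  rw [transp, V_inv hθ, Matrix.transpose_single, Matrix.smul_mul, Matrix.smul_mul, h1,
    antidiagEntry_rev hθ, smul_smul, ← mul_assoc, ← mul_assoc, sq_eq_one_of_sign hθ, one_mul]

/-- The projection `A ↦ A - A^t`, twice the skew part of `A`. -/
noncomputable def skew (N : ℕ) (θ₀ : ℂ) :
    Matrix (Fin N) (Fin N) ℂ →ₗ[ℂ] Matrix (Fin N) (Fin N) ℂ where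
  toFun A := A - transp N θ₀ A
  map_add' A B := by simp only [transp, Matrix.transpose_add, mul_add, add_mul]; abel
  map_smul' c A := by simp [transp, smul_sub]

theorem skew_apply (A : Matrix (Fin N) (Fin N) ℂ) : skew N θ₀ A = A - transp N θ₀ A := rfl

theorem skew_transp (hθ : θ₀ = 1 ∨ (θ₀ = -1 ∧ Even N)) (A : Matrix (Fin N) (Fin N) ℂ) :
    skew N θ₀ (transp N θ₀ A) = -skew N θ₀ A := by
  rw [skew_apply, skew_apply, transp_transp hθ, neg_sub]

/-- As `t` is an anti-involution, `[A, B]^t = -[A^t, B^t]`; the four terms of the bracket then pair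
up. -/
theorem lie_skew (hθ : θ₀ = 1 ∨ (θ₀ = -1 ∧ Even N)) (A B : Matrix (Fin N) (Fin N) ℂ) :
    ⁅skew N θ₀ A, skew N θ₀ B⁆ = skew N θ₀ ⁅A, B⁆ - skew N θ₀ ⁅A, transp N θ₀ B⁆ := by
  simp only [Ring.lie_def, map_sub]
  simp only [skew_apply, transp_mul hθ, transp_transp hθ]
  noncomm_ring

theorem mem_lieV (hθ : θ₀ = 1 ∨ (θ₀ = -1 ∧ Even N)) (X : Matrix (Fin N) (Fin N) ℂ) :
    X ∈ lieV N θ₀ ↔ transp N θ₀ X = -X := by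
  rw [mem_skewAdjointMatricesLieSubalgebra, mem_skewAdjointMatricesSubmodule,
    Matrix.IsSkewAdjoint, Matrix.IsAdjointPair, transp]
  constructor
  · intro h
    rw [Matrix.mul_assoc, h, ← Matrix.mul_assoc, V_inv_mul hθ, Matrix.one_mul]
  · intro h
    rw [← h, Matrix.mul_assoc, ← Matrix.mul_assoc (V N θ₀), V_mul_inv hθ, Matrix.one_mul]

theorem skew_mem (hθ : θ₀ = 1 ∨ (θ₀ = -1 ∧ Even N)) (A : Matrix (Fin N) (Fin N) ℂ) :
    skew N θ₀ A ∈ lieV N θ₀ := by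
  rw [mem_lieV hθ]
  have h : ∀ B C : Matrix (Fin N) (Fin N) ℂ,
      transp N θ₀ (B - C) = transp N θ₀ B - transp N θ₀ C := fun B C => by
    simp only [transp, Matrix.transpose_sub, mul_sub, sub_mul]
  rw [skew_apply, h, transp_transp hθ, neg_sub]

/-- The defining relation of the Lie algebra transported through `V⁻¹ = θ₀ V`; this form makes `X ⊗
1 + 1 ⊗ X` kill the column vector of `V`. -/
theorem V_mul_transpose_of_mem (hθ : θ₀ = 1 ∨ (θ₀ = -1 ∧ Even N))
    {X : Matrix (Fin N) (Fin N) ℂ} (hX : X ∈ lieV N θ₀) :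
    X * V N θ₀ + V N θ₀ * X.transpose = 0 := by
  have h := (mem_lieV hθ X).1 hX
  rw [transp, V_inv hθ] at h
  have h2 := congrArg (· * V N θ₀) h
  simp only [Matrix.smul_mul, Matrix.mul_assoc, V_mul_V hθ, Matrix.mul_smul, Matrix.mul_one,
    smul_smul, sq_eq_one_of_sign hθ, one_smul, Matrix.neg_mul] at h2
  rw [h2, add_neg_cancel]

theorem transpose_mul_V_of_mem {X : Matrix (Fin N) (Fin N) ℂ} (hX : X ∈ lieV N θ₀) :
    X.transpose * V N θ₀ + V N θ₀ * X = 0 := by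
  rw [mem_skewAdjointMatricesLieSubalgebra, mem_skewAdjointMatricesSubmodule,
    Matrix.IsSkewAdjoint, Matrix.IsAdjointPair] at hX
  rw [hX, Matrix.mul_neg, neg_add_cancel]

end Antidiagonal

/-! ### The two-site operators -/

section TwoSites

variable {N : ℕ} {θ₀ : ℂ}

theorem permOp_apply (p q : Fin N × Fin N) :
    permOp N p q = if p.1 = q.2 ∧ p.2 = q.1 then 1 else 0 := by
  rw [permOp, Matrix.sum_apply, Finset.sum_eq_single p.1]
  · rw [Matrix.sum_apply, Finset.sum_eq_single p.2]
    · by_cases h1 : p.1 = q.2 <;> by_cases h2 : p.2 = q.1 <;>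
        simp [Matrix.kroneckerMap_apply, h1, h2]
    · intro j _ hj
      simp [Matrix.kroneckerMap_apply, Matrix.single_apply, hj]
    · simp
  · intro i _ hi
    rw [Matrix.sum_apply]
    exact Finset.sum_eq_zero fun j _ => by
      simp [Matrix.kroneckerMap_apply, Matrix.single_apply, hi]
  · simp

/-- The plain partial transpose of `P` is `δ δᵀ` with `δ` the diagonal vector; conjugation by `V`
turns each `δ` into the vector of `V`, up to signs with `θ₀² = 1`. -/
theorem Q_eq (hθ : θ₀ = 1 ∨ (θ₀ = -1 ∧ Even N)) :
    Q N θ₀ = Matrix.vecMulVec (fun p => V N θ₀ p.1 p.2) (fun p => V N θ₀ p.1 p.2) := by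
  have hV : ∀ a b, θ₀ * V N θ₀ a b = V N θ₀ b a := fun a b =>
    (congrFun (congrFun (V_transpose hθ) a) b).symm
  have h : (Matrix.of fun p q : Fin N × Fin N => permOp N (q.1, p.2) (p.1, q.2)) =
      Matrix.vecMulVec (fun p => if p.2 = p.1 then 1 else 0)
        (fun q => if q.1 = q.2 then 1 else 0) := by
    ext p q
    simp only [Matrix.of_apply, permOp_apply, Matrix.vecMulVec_apply, ite_and]
    split_ifs <;> simp
  have h1 : (Matrix.kronecker (V N θ₀)⁻¹ 1).mulVec (fun p => if p.2 = p.1 then 1 else 0) =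
      fun p => V N θ₀ p.2 p.1 := by
    ext p
    simp [Matrix.mulVec, dotProduct, Fintype.sum_prod_type, Matrix.kronecker,
      Matrix.kroneckerMap_apply, Matrix.one_apply, V_inv hθ, hV]
  have h2 : Matrix.vecMul (fun p => if p.1 = p.2 then 1 else 0) (Matrix.kronecker (V N θ₀) 1) =
      fun p => V N θ₀ p.2 p.1 := by
    ext p
    simp [Matrix.vecMul, dotProduct, Fintype.sum_prod_type, Matrix.kronecker,
      Matrix.kroneckerMap_apply, Matrix.one_apply]
  rw [Q, transp₁, h, Matrix.mul_vecMulVec, Matrix.vecMulVec_mul, h1, h2]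
  ext p q
  simp only [Matrix.vecMulVec_apply]
  rw [← hV p.1, ← hV q.1]
  linear_combination V N θ₀ p.1 p.2 * V N θ₀ q.1 q.2 * sq_eq_one_of_sign hθ

theorem permOp_mul (M : Matrix (Fin N × Fin N) (Fin N × Fin N) ℂ) :
    permOp N * M = M.submatrix Prod.swap id := by
  ext p q
  rw [Matrix.mul_apply, Finset.sum_eq_single p.swap]
  · simp [permOp_apply]
  · rintro ⟨a, b⟩ _ h
    rw [permOp_apply, if_neg, zero_mul]
    rintro ⟨h1, h2⟩
    exact h (Prod.ext h2.symm h1.symm)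
  · simp

theorem mul_permOp (M : Matrix (Fin N × Fin N) (Fin N × Fin N) ℂ) :
    M * permOp N = M.submatrix id Prod.swap := by
  ext p q
  rw [Matrix.mul_apply, Finset.sum_eq_single q.swap]
  · simp [permOp_apply]
  · rintro ⟨a, b⟩ _ h
    rw [permOp_apply, if_neg, mul_zero]
    rintro ⟨h1, h2⟩
    exact h (Prod.ext h1 h2)
  · simp

theorem permOp_commute (X : Matrix (Fin N) (Fin N) ℂ) :
    Commute (permOp N) (Matrix.kronecker X 1 + Matrix.kronecker 1 X) := by
  rw [Commute, SemiconjBy, permOp_mul, mul_permOp]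
  ext ⟨a, b⟩ ⟨c, d⟩
  simp [Matrix.kroneckerMap_apply, Matrix.one_apply, add_comm, mul_comm]

/-- Both products vanish, since the vector of `V` is annihilated from the left and from the right.
-/
theorem Q_commute (hθ : θ₀ = 1 ∨ (θ₀ = -1 ∧ Even N)) {X : Matrix (Fin N) (Fin N) ℂ}
    (hX : X ∈ lieV N θ₀) :
    Commute (Q N θ₀) (Matrix.kronecker X 1 + Matrix.kronecker 1 X) := by
  rw [Commute, SemiconjBy, Q_eq hθ, Matrix.mul_vecMulVec, Matrix.vecMulVec_mul]
  have h1 : (Matrix.kronecker X 1 + Matrix.kronecker 1 X).mulVec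
      (fun p => V N θ₀ p.1 p.2) = 0 := by
    ext ⟨a, b⟩
    have := congrFun (congrFun (V_mul_transpose_of_mem hθ hX) a) b
    simp only [Matrix.add_apply, Matrix.mul_apply, Matrix.transpose_apply] at this
    simp only [Matrix.mulVec, dotProduct, Fintype.sum_prod_type, Matrix.add_apply,
      Matrix.kronecker, Matrix.kroneckerMap_apply, Matrix.one_apply, add_mul,
      Finset.sum_add_distrib]
    simpa [mul_comm] using this
  have h2 : Matrix.vecMul (fun p => V N θ₀ p.1 p.2)
      (Matrix.kronecker X 1 + Matrix.kronecker 1 X) = 0 := by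
    ext ⟨a, b⟩
    have := congrFun (congrFun (transpose_mul_V_of_mem hX) a) b
    simp only [Matrix.add_apply, Matrix.mul_apply, Matrix.transpose_apply] at this
    simp only [Matrix.vecMul, dotProduct, Fintype.sum_prod_type, Matrix.add_apply,
      Matrix.kronecker, Matrix.kroneckerMap_apply, Matrix.one_apply, mul_add,
      Finset.sum_add_distrib]
    simpa [mul_comm] using this
  rw [h1, h2]
  simp

theorem permHat_commute (hθ : θ₀ = 1 ∨ (θ₀ = -1 ∧ Even N)) {X : Matrix (Fin N) (Fin N) ℂ}
    (hX : X ∈ lieV N θ₀) :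
    Commute (permHat N θ₀) (Matrix.kronecker X 1 + Matrix.kronecker 1 X) :=
  ((Commute.one_left _).smul_left _).sub_left (Q_commute hθ hX)

theorem transp₁_one (hθ : θ₀ = 1 ∨ (θ₀ = -1 ∧ Even N)) : transp₁ N θ₀ 1 = 1 := by
  have h : (Matrix.of fun p q : Fin N × Fin N =>
      (1 : Matrix (Fin N × Fin N) (Fin N × Fin N) ℂ) (q.1, p.2) (p.1, q.2)) = 1 := by
    ext p q
    simp only [Matrix.of_apply, Matrix.one_apply, Prod.ext_iff, eq_comm]
  rw [transp₁, h, mul_one]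
  refine (Matrix.mul_kronecker_mul _ _ _ _).symm.trans ?_
  rw [V_inv_mul hθ, mul_one, Matrix.one_kronecker_one]

/-- The shift by `iρ` combines with `Q` into `P̂`: `-λ - iρ + iQ = -(λ + i(ρ - Q))`. -/
theorem Rbar_eq (hθ : θ₀ = 1 ∨ (θ₀ = -1 ∧ Even N)) (lam : ℂ) :
    Rbar N θ₀ lam = (-1 : ℂ) •
      (lam • (1 : Matrix (Fin N × Fin N) (Fin N × Fin N) ℂ) + Complex.I • permHat N θ₀) := by
  have h : ∀ (a b : ℂ) (A B : Matrix (Fin N × Fin N) (Fin N × Fin N) ℂ),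
      transp₁ N θ₀ (a • A + b • B) = a • transp₁ N θ₀ A + b • transp₁ N θ₀ B := by
    intro a b A B
    simp only [transp₁]
    rw [← Matrix.smul_mul, ← Matrix.mul_smul, ← Matrix.smul_mul b, ← Matrix.mul_smul _ b,
      ← Matrix.add_mul, ← Matrix.mul_add]
    rfl
  rw [Rbar, R, h, transp₁_one hθ, permHat, Q]
  module

theorem permOp_swap : (permOp N).submatrix Prod.swap Prod.swap = permOp N := by
  ext p q
  simp [permOp_apply, and_comm]

/-- Swapping factors multiplies the vector of `V` by `θ₀`, which enters `Q` squared. -/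
theorem permHat_swap (hθ : θ₀ = 1 ∨ (θ₀ = -1 ∧ Even N)) :
    (permHat N θ₀).submatrix Prod.swap Prod.swap = permHat N θ₀ := by
  have hV : ∀ a b, θ₀ * V N θ₀ a b = V N θ₀ b a := fun a b =>
    (congrFun (congrFun (V_transpose hθ) a) b).symm
  ext ⟨a, b⟩ ⟨c, d⟩
  simp only [permHat, Q_eq hθ, Matrix.submatrix_apply, Matrix.sub_apply, Matrix.smul_apply,
    Matrix.vecMulVec_apply, Prod.swap_prod_mk, Matrix.one_apply, Prod.ext_iff, and_comm]
  rw [← hV a b, ← hV c d]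
  linear_combination -V N θ₀ a b * V N θ₀ c d * sq_eq_one_of_sign hθ

end TwoSites

end SNPChain

namespace SNPChain

/-! ### The generators -/

section Generators

variable {N L : ℕ} {θ₀ : ℂ}

theorem S_one (j : Fin (2 * L)) :
    S N L θ₀ 1 j = onSites 0 j.succ (permOp N) + onSites 0 j.succ (permHat N θ₀) := by
  unfold S
  split_ifs <;> simp [onSite_one]

theorem slice_permOp (a b : Fin N) :
    (Matrix.of fun x y => permOp N (a, x) (b, y)) = Matrix.single b a 1 := by
  ext x y
  simp only [Matrix.of_apply, permOp_apply, Matrix.single_apply]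
  exact if_congr ⟨fun h => ⟨h.2.symm, h.1⟩, fun h => ⟨h.2, h.1.symm⟩⟩ rfl rfl

theorem slice_permHat (hθ : θ₀ = 1 ∨ (θ₀ = -1 ∧ Even N)) (a b : Fin N) :
    (Matrix.of fun x y => permHat N θ₀ (a, x) (b, y)) =
      (if a = b then rho N • 1 else 0) - transp N θ₀ (Matrix.single b a 1) := by
  ext x y
  have h : V N θ₀ a x * V N θ₀ b y =
      (antidiagEntry N θ₀ a * antidiagEntry N θ₀ b) * Matrix.single a.rev b.rev 1 x y := by
    rw [V_apply, V_apply, Matrix.single_apply]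
    by_cases h1 : x = a.rev <;> by_cases h2 : y = b.rev <;> simp [h1, h2, eq_comm (a := a.rev), eq_comm (a := b.rev)]
  simp only [Matrix.of_apply, permHat, Q_eq hθ, Matrix.sub_apply, Matrix.vecMulVec_apply,
    transp_single hθ, Matrix.smul_apply, smul_eq_mul, h]
  by_cases hab : a = b <;> simp [Matrix.one_apply, Prod.ext_iff, hab]

/-- At each site `P` contributes `E_ba`, and `P̂` contributes `ρ δ_ab - (E_ba)^t`; over `2L` sites
the scalars add up to `2Lρ = LN`. -/
theorem gen_eq_diagonal (hθ : θ₀ = 1 ∨ (θ₀ = -1 ∧ Even N)) (a b : Fin N) :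
    gen N L θ₀ a b = diagonal (skew N θ₀ (Matrix.single b a 1)) +
      if a = b then (L * N : ℂ) • (1 : Op (2 * L) N) else 0 := by
  have h : ∀ j : Fin (2 * L), component₀ (S N L θ₀ 1 j) a b =
      onSite j (skew N θ₀ (Matrix.single b a 1) + if a = b then rho N • 1 else 0) := by
    intro j
    rw [S_one, component₀_add, component₀_onSites, component₀_onSites, slice_permOp,
      slice_permHat hθ, ← onSiteHom_apply, ← onSiteHom_apply, ← map_add, onSiteHom_apply,
      skew_apply]
    congr 1
    abel
  rw [gen, Stot, component₀_sum]
  simp only [h]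
  rw [← diagonal_apply, map_add]
  congr 1
  split_ifs
  · rw [map_smul, diagonal_one, smul_smul, rho]
    congr 1
    push_cast
    ring
  · exact map_zero _

theorem skew_single_rev (hθ : θ₀ = 1 ∨ (θ₀ = -1 ∧ Even N)) (a b : Fin N) :
    (antidiagEntry N θ₀ a * antidiagEntry N θ₀ b) • skew N θ₀ (Matrix.single a.rev b.rev 1) =
      -skew N θ₀ (Matrix.single b a 1) := by
  rw [← map_smul, ← transp_single hθ, skew_transp hθ]

theorem gen_add_gen_rev (hθ : θ₀ = 1 ∨ (θ₀ = -1 ∧ Even N)) (a b : Fin N) :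
    gen N L θ₀ a b
        + (antidiagEntry N θ₀ a * antidiagEntry N θ₀ b) • gen N L θ₀ b.rev a.rev =
      if a = b then (2 * L * N : ℂ) • (1 : Op (2 * L) N) else 0 := by
  rw [gen_eq_diagonal hθ, gen_eq_diagonal hθ, smul_add, ← map_smul, skew_single_rev hθ, map_neg]
  by_cases h : a = b
  · subst h
    rw [if_pos rfl, if_pos rfl, if_pos rfl, antidiagEntry_mul_self hθ]
    module
  · rw [if_neg h, if_neg h, if_neg (fun h' => h (Fin.rev_injective h').symm)]
    simp

theorem lie_single (a b c d : Fin N) :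
    ⁅(Matrix.single a b (1 : ℂ)), (Matrix.single c d (1 : ℂ))⁆ =
      (if b = c then Matrix.single a d 1 else 0) - if d = a then Matrix.single c b 1 else 0 := by
  rw [Ring.lie_def]
  congr 1
  · split_ifs with h
    · subst h; simp
    · simp [h]
  · split_ifs with h
    · subst h; simp
    · simp [h]

theorem lie_add_smul_one {n : ℕ} (A B : Op n N) (x y : ℂ) :
    ⁅A + x • (1 : Op n N), B + y • (1 : Op n N)⁆ = ⁅A, B⁆ := by
  simp only [Ring.lie_def, mul_add, add_mul, Matrix.smul_mul, Matrix.mul_smul, one_mul, mul_one]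
  rw [smul_comm]
  abel

theorem lie_gen (hθ : θ₀ = 1 ∨ (θ₀ = -1 ∧ Even N)) (a b c d : Fin N) :
    ⁅gen N L θ₀ a b, gen N L θ₀ c d⁆ =
      (if a = d then gen N L θ₀ c b else 0)
      - (if c = b then gen N L θ₀ a d else 0)
      - (antidiagEntry N θ₀ c * antidiagEntry N θ₀ d) •
        ((if a = c.rev then gen N L θ₀ d.rev b else 0)
          - (if b = d.rev then gen N L θ₀ a c.rev else 0)) := by
  have hg : ∀ a b, gen N L θ₀ a b = diagonal (skew N θ₀ (Matrix.single b a 1)) +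
      (if a = b then (L * N : ℂ) else 0) • (1 : Op (2 * L) N) := by
    intro a b
    rw [gen_eq_diagonal hθ, ite_smul, zero_smul]
  have h1 : ⁅gen N L θ₀ a b, gen N L θ₀ c d⁆ =
      diagonal ((if a = d then skew N θ₀ (Matrix.single b c 1) else 0)
      - (if c = b then skew N θ₀ (Matrix.single d a 1) else 0)
      - (antidiagEntry N θ₀ c * antidiagEntry N θ₀ d) •
        ((if a = c.rev then skew N θ₀ (Matrix.single b d.rev 1) else 0)
          - (if b = d.rev then skew N θ₀ (Matrix.single c.rev a 1) else 0))) := by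
    rw [hg, hg, lie_add_smul_one, ← diagonal_lie, lie_skew hθ, transp_single hθ, lie_smul,
      lie_single, lie_single]
    simp only [map_sub, map_smul, apply_ite (skew N θ₀), map_zero, eq_comm (a := d.rev)]
  rw [h1]
  simp only [map_sub, map_smul, apply_ite (diagonal (n := 2 * L) (N := N)), map_zero, hg]
  -- The central shifts are absent from the commutator, so on the right they must cancel in pairs:
  -- `k1` handles the first two terms, `k2` the terms with reversed indices.
  have k1 : ((if a = d then (if c = b then (L * N : ℂ) else 0) • (1 : Op (2 * L) N) else 0)
      = if c = b then (if a = d then (L * N : ℂ) else 0) • (1 : Op (2 * L) N) else 0) := by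
    split_ifs <;> simp
  have k2 : ((if a = c.rev then (if d.rev = b then (L * N : ℂ) else 0) • (1 : Op (2 * L) N) else 0)
      = if b = d.rev then (if a = c.rev then (L * N : ℂ) else 0) • (1 : Op (2 * L) N) else 0) := by
    simp only [eq_comm (a := b)]
    split_ifs <;> simp
  have hadd : ∀ (p : Prop) [Decidable p] (A B : Op (2 * L) N),
      (if p then A + B else 0) = (if p then A else 0) + if p then B else 0 := by
    intro p _ A B
    split_ifs <;> simp
  simp only [hadd]
  rw [k1, k2]
  module

/-- The generators `F^{ab}` of the Lie algebra of `V`. -/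
noncomputable def generator (hθ : θ₀ = 1 ∨ (θ₀ = -1 ∧ Even N)) (a b : Fin N) : lieV N θ₀ :=
  ⟨skew N θ₀ (Matrix.single b a 1), skew_mem hθ _⟩

theorem span_generator (hθ : θ₀ = 1 ∨ (θ₀ = -1 ∧ Even N)) :
    Submodule.span ℂ (Set.range fun p : Fin N × Fin N => generator hθ p.1 p.2) = ⊤ := by
  rw [eq_top_iff]
  rintro ⟨X, hX⟩ _
  -- Since `X^t = -X`, one has `X = (X - X^t) / 2`; expand `X` in matrix units.
  have h : (⟨X, hX⟩ : lieV N θ₀) =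
      ∑ i, ∑ j, ((1 / 2 : ℂ) * X i j) • generator hθ j i := by
    apply Subtype.ext
    have h2 : X = (1 / 2 : ℂ) • skew N θ₀ X := by
      rw [skew_apply, (mem_lieV hθ X).1 hX, sub_neg_eq_add]
      module
    have h3 : skew N θ₀ X = ∑ i, ∑ j, X i j • skew N θ₀ (Matrix.single i j 1) := by
      conv_lhs => rw [Matrix.matrix_eq_sum_single X]
      simp only [map_sum, ← map_smul, Matrix.smul_single, smul_eq_mul, mul_one]
    simp only [AddSubmonoidClass.coe_finsetSum, SetLike.val_smul, generator]
    rw [h3, Finset.smul_sum] at h2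
    simp only [Finset.smul_sum, smul_smul] at h2
    exact h2
  rw [h]
  exact Submodule.sum_mem _ fun i _ => Submodule.sum_mem _ fun j _ =>
    Submodule.smul_mem _ _ (Submodule.subset_span ⟨(j, i), rfl⟩)

/-- The diagonal action of the Lie algebra of `V`. -/
noncomputable def diagonalLieHom (n : ℕ) (N : ℕ) (θ₀ : ℂ) : lieV N θ₀ →ₗ⁅ℂ⁆ Op n N where
  toLinearMap := diagonal ∘ₗ (lieV N θ₀).toSubmodule.subtype
  map_lie' {X Y} := diagonal_lie (X : Matrix (Fin N) (Fin N) ℂ) Y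

end Generators

/-! ### Symmetry of the transfer matrix -/

section Symmetry

variable {N L : ℕ} {θ₀ : ℂ}

theorem onSites_R_swap (i j : Fin (2 * L + 1)) (lam : ℂ) :
    onSites j i (R N lam) = onSites i j (R N lam) := by
  rw [onSites_swap i j]
  congr 1
  have h := permOp_swap (N := N)
  ext p q
  have := congrFun (congrFun h p) q
  simp only [Matrix.submatrix_apply] at this
  simp [R, this, Matrix.one_apply]

theorem onSites_Rbar_swap (hθ : θ₀ = 1 ∨ (θ₀ = -1 ∧ Even N)) (i j : Fin (2 * L + 1)) (lam : ℂ) :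
    onSites j i (Rbar N θ₀ lam) = onSites i j (Rbar N θ₀ lam) := by
  rw [onSites_swap i j]
  congr 1
  have h := permHat_swap (N := N) hθ
  ext p q
  have := congrFun (congrFun h p) q
  simp only [Matrix.submatrix_apply] at this
  simp [Rbar_eq hθ, this, Matrix.one_apply, add_comm]

theorem That_eq (hθ : θ₀ = 1 ∨ (θ₀ = -1 ∧ Even N)) (lam : ℂ) :
    That N L θ₀ lam = ((List.finRange (2 * L)).map fun j =>
      onSites 0 j.succ (if Even (j.succ : ℕ) then Rbar N θ₀ lam else R N lam)).prod := by
  unfold That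
  congr 2
  funext j
  split_ifs
  · exact onSites_Rbar_swap hθ _ _ _
  · exact onSites_R_swap _ _ _

theorem R_commute (lam : ℂ) (X : Matrix (Fin N) (Fin N) ℂ) :
    Commute (R N lam) (Matrix.kronecker X 1 + Matrix.kronecker 1 X) :=
  ((Commute.one_left _).smul_left _).add_left ((permOp_commute X).smul_left _)

theorem Rbar_commute (hθ : θ₀ = 1 ∨ (θ₀ = -1 ∧ Even N)) (lam : ℂ)
    {X : Matrix (Fin N) (Fin N) ℂ} (hX : X ∈ lieV N θ₀) :
    Commute (Rbar N θ₀ lam) (Matrix.kronecker X 1 + Matrix.kronecker 1 X) := by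
  rw [Rbar_eq hθ]
  exact (((Commute.one_left _).smul_left _).add_left
    ((permHat_commute hθ hX).smul_left _)).smul_left _

theorem monodromy_one (lam : ℂ) :
    monodromy N L θ₀ 1 lam = T N L θ₀ lam * That N L θ₀ lam := by
  rw [monodromy, onSite_one, mul_one]

theorem monodromy_commute (hθ : θ₀ = 1 ∨ (θ₀ = -1 ∧ Even N)) (lam : ℂ)
    {X : Matrix (Fin N) (Fin N) ℂ} (hX : X ∈ lieV N θ₀) :
    Commute (monodromy N L θ₀ 1 lam) (diagonal X) := by
  rw [monodromy_one, That_eq hθ, T]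
  have h : ∀ (p : Prop) [Decidable p] (A B : Matrix (Fin N × Fin N) (Fin N × Fin N) ℂ)
      (j : Fin (2 * L)), Commute A (Matrix.kronecker X 1 + Matrix.kronecker 1 X) →
      Commute B (Matrix.kronecker X 1 + Matrix.kronecker 1 X) →
      Commute (onSites 0 j.succ (if p then A else B)) (diagonal X) := by
    intro p _ A B j hA hB
    refine onSites_commute_diagonal (Fin.succ_ne_zero j).symm ?_
    split_ifs <;> assumption
  refine Commute.mul_left ?_ ?_
  · refine Commute.list_prod_left _ _ fun A hA => ?_
    obtain ⟨j, _, rfl⟩ := List.mem_map.1 hA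
    exact h _ _ _ _ (R_commute lam X) (Rbar_commute hθ lam hX)
  · refine Commute.list_prod_left _ _ fun A hA => ?_
    obtain ⟨j, _, rfl⟩ := List.mem_map.1 hA
    exact h _ _ _ _ (Rbar_commute hθ lam hX) (R_commute lam X)

theorem lie_transfer_gen (hθ : θ₀ = 1 ∨ (θ₀ = -1 ∧ Even N)) (lam : ℂ) (a b : Fin N) :
    ⁅transfer N L θ₀ 1 1 lam, gen N L θ₀ a b⁆ = 0 := by
  have h : Commute (transfer N L θ₀ 1 1 lam) (diagonal (skew N θ₀ (Matrix.single b a 1))) := by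
    rw [transfer, onSite_one, one_mul]
    exact trace₀_commute_diagonal (monodromy_commute hθ lam (skew_mem hθ _))
  rw [← commute_iff_lie_eq, gen_eq_diagonal hθ]
  refine h.add_right ?_
  split_ifs
  · exact (Commute.one_right _).smul_right _
  · exact Commute.zero_right _

end Symmetry

end SNPChain

namespace SNPChain

/-! ### Asymptotics of the monodromy matrix -/

section Asymptotics

/-- The remainder is a function of `u = 1/λ` continuous also at `u = 0`, which makes it bounded at
infinity. -/
theorem exists_expansion_prod {n N : ℕ} (l : List (ℂ × Op n N)) :
    ∃ q : ℂ → Op n N, Continuous q ∧ ∀ lam : ℂ, lam ≠ 0 →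
      (l.map fun p => p.1 • (lam • (1 : Op n N) + Complex.I • p.2)).prod =
        ((l.map Prod.fst).prod * lam ^ l.length) •
          (1 + (Complex.I * lam⁻¹) • (l.map Prod.snd).sum + (lam⁻¹ ^ 2) • q lam⁻¹) := by
  induction l with
  | nil => exact ⟨fun _ => 0, continuous_const, fun lam _ => by simp⟩
  | cons p l ih =>
    obtain ⟨q, hq, h⟩ := ih
    -- Coefficient of `u²` in `(1 + iuA)(1 + iuB + u²q)`, where `A` is the new operator and `B` the
    -- sum of the old ones; the minus sign is `i²`.
    refine ⟨fun u => q u - p.2 * (l.map Prod.snd).sum + (Complex.I * u) • (p.2 * q u), ?_, ?_⟩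
    · fun_prop
    · intro lam hlam
      have h1 : lam • (1 : Op n N) + Complex.I • p.2 =
          lam • (1 + (Complex.I * lam⁻¹) • p.2) := by
        rw [smul_add, smul_smul, mul_left_comm, mul_inv_cancel₀ hlam, mul_one]
      rw [List.map_cons, List.prod_cons, h lam hlam, h1, smul_smul, smul_mul_smul_comm,
        List.map_cons, List.prod_cons, List.map_cons, List.sum_cons, List.length_cons]
      congr 1
      · ring
      · simp only [mul_add, add_mul, one_mul, mul_one, smul_mul_assoc, mul_smul_comm]
        generalize p.2 * (l.map Prod.snd).sum = A
        generalize p.2 * q lam⁻¹ = B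
        match_scalars <;> ring_nf
        simp [Complex.I_sq]

variable {N L : ℕ} {θ₀ : ℂ}

theorem onSites_R (j : Fin (2 * L)) (lam : ℂ) :
    onSites 0 j.succ (R N lam) =
      (1 : ℂ) • (lam • (1 : Op (2 * L + 1) N) + Complex.I • onSites 0 j.succ (permOp N)) := by
  rw [R, ← onSitesHom_apply, map_add, map_smul, map_smul, onSitesHom_apply, onSitesHom_apply,
    onSites_one (Fin.succ_ne_zero j).symm, one_smul]

theorem onSites_Rbar (hθ : θ₀ = 1 ∨ (θ₀ = -1 ∧ Even N)) (j : Fin (2 * L)) (lam : ℂ) :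
    onSites 0 j.succ (Rbar N θ₀ lam) =
      (-1 : ℂ) • (lam • (1 : Op (2 * L + 1) N) +
        Complex.I • onSites 0 j.succ (permHat N θ₀)) := by
  rw [Rbar_eq hθ, ← onSitesHom_apply, map_smul, map_add, map_smul, map_smul, onSitesHom_apply,
    onSitesHom_apply, onSites_one (Fin.succ_ne_zero j).symm]

theorem exists_expansion_monodromy (hθ : θ₀ = 1 ∨ (θ₀ = -1 ∧ Even N)) :
    ∃ q : ℂ → Op (2 * L + 1) N, Continuous q ∧ ∀ lam : ℂ, lam ≠ 0 →
      monodromy N L θ₀ 1 lam = lam ^ (4 * L) •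
        (1 + (Complex.I * lam⁻¹) • Stot N L θ₀ + (lam⁻¹ ^ 2) • q lam⁻¹) := by
  -- `F` and `G` record the sign and operator of each factor `±(λ + i A)` in `T` and `That`.
  let F : Fin (2 * L) → ℂ × Op (2 * L + 1) N := fun j =>
    if Even (j.succ : ℕ) then (1, onSites 0 j.succ (permOp N))
    else (-1, onSites 0 j.succ (permHat N θ₀))
  let G : Fin (2 * L) → ℂ × Op (2 * L + 1) N := fun j =>
    if Even (j.succ : ℕ) then (-1, onSites 0 j.succ (permHat N θ₀))
    else (1, onSites 0 j.succ (permOp N))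
  obtain ⟨q, hq, h⟩ := exists_expansion_prod
    ((List.finRange (2 * L)).reverse.map F ++ (List.finRange (2 * L)).map G)
  refine ⟨q, hq, fun lam hlam => ?_⟩
  have hlen : ((List.finRange (2 * L)).reverse.map F ++
      (List.finRange (2 * L)).map G).length = 4 * L := by
    simp only [List.length_append, List.length_map, List.length_reverse, List.length_finRange]
    ring
  have hsum : (((List.finRange (2 * L)).reverse.map F ++
      (List.finRange (2 * L)).map G).map Prod.snd).sum = Stot N L θ₀ := by
    rw [List.map_append, List.sum_append, List.map_reverse, List.map_reverse, List.sum_reverse,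
      List.map_map, List.map_map, ← Fin.sum_univ_def, ← Fin.sum_univ_def,
      ← Finset.sum_add_distrib, Stot]
    refine Finset.sum_congr rfl fun j _ => ?_
    rw [S_one]
    simp only [Function.comp_apply, F, G]
    split_ifs
    · rfl
    · exact add_comm _ _
  have hprod : (((List.finRange (2 * L)).reverse.map F ++
      (List.finRange (2 * L)).map G).map Prod.fst).prod = 1 := by
    rw [List.map_append, List.prod_append, List.map_reverse, List.map_reverse, List.prod_reverse,
      List.map_map, List.map_map, ← Fin.prod_univ_def, ← Fin.prod_univ_def,
      ← Finset.prod_mul_distrib]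
    -- Each site meets one `R` and one `R̄`, hence a single sign; the number of sites is even.
    have : ∀ j, (Prod.fst ∘ F) j * (Prod.fst ∘ G) j = -1 := by
      intro j
      simp only [Function.comp_apply, F, G]
      split_ifs <;> norm_num
    simp only [this]
    simp
  have h2 := h lam hlam
  rw [hlen, hsum, hprod, one_mul] at h2
  rw [← h2, monodromy_one, That_eq hθ, T, List.map_append, List.prod_append, List.map_map,
    List.map_map]
  congr 3
  · funext j
    simp only [Function.comp_apply, F]
    split_ifs
    · exact onSites_R j lam
    · exact onSites_Rbar hθ j lam
  · funext j
    simp only [Function.comp_apply, G]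
    split_ifs
    · exact onSites_Rbar hθ j lam
    · exact onSites_R j lam

theorem monodromy_isBigO (hθ : θ₀ = 1 ∨ (θ₀ = -1 ∧ Even N)) (f g : Fin (2 * L + 1) → Fin N) :
    (fun lam : ℂ => (lam ^ (4 * L))⁻¹ * monodromy N L θ₀ 1 lam f g
        - (1 : Op (2 * L + 1) N) f g - Complex.I / lam * Stot N L θ₀ f g)
      =O[Bornology.cobounded ℂ] (fun lam : ℂ => (lam ^ 2)⁻¹) := by
  obtain ⟨q, hq, h⟩ := exists_expansion_monodromy (N := N) (L := L) hθ
  have hq0 : (fun lam : ℂ => q lam⁻¹ f g) =O[Bornology.cobounded ℂ] (fun _ => (1 : ℂ)) := by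
    have h1 : Filter.Tendsto (fun u => q u f g) (nhds 0) (nhds (q 0 f g)) :=
      (hq.matrix_elem f g).tendsto 0
    exact (h1.comp Filter.tendsto_inv₀_cobounded).isBigO_one ℂ
  have h3 := (Asymptotics.isBigO_refl (fun lam : ℂ => (lam ^ 2)⁻¹)
    (Bornology.cobounded ℂ)).mul hq0
  simp only [mul_one] at h3
  refine h3.congr' ?_ Filter.EventuallyEq.rfl
  filter_upwards [Bornology.eventually_ne_cobounded (0 : ℂ)] with lam hlam
  rw [h lam hlam]
  simp only [Matrix.smul_apply, Matrix.add_apply, smul_eq_mul]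
  rw [← mul_assoc, inv_mul_cancel₀ (pow_ne_zero _ hlam)]
  ring

end Asymptotics

/-! ### Identification with the classical Lie algebras -/

section Classical

variable {N : ℕ}

theorem nonempty_lieV_equiv_so :
    Nonempty (lieV N 1 ≃ₗ⁅ℂ⁆ LieAlgebra.Orthogonal.so (Fin N) ℂ) := by
  have hθ : (1 : ℂ) = 1 ∨ ((1 : ℂ) = -1 ∧ Even N) := Or.inl rfl
  -- `P` is a symmetric square root of `V`: as `V² = 1`, `(1 + iV)² = 2iV`, and `α` is chosen with
  -- `2iα² = 1`. Hence `Pᵀ V P = V P² = 1`.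
  let α : ℂ := (1 - Complex.I) / 2
  let P : Matrix (Fin N) (Fin N) ℂ := α • (1 + Complex.I • V N 1)
  have hVV : V N 1 * V N 1 = 1 := by rw [V_mul_V hθ, one_smul]
  have hα : α ^ 2 * 2 * Complex.I = 1 := by
    simp only [α]
    linear_combination -Complex.I_sq * (1 - Complex.I / 2)
  have hP : P.transpose * V N 1 * P = 1 := by
    have hPt : P.transpose = P := by
      simp only [P, Matrix.transpose_smul, Matrix.transpose_add, Matrix.transpose_one,
        V_transpose hθ, one_smul]
    rw [hPt]
    simp only [P, Matrix.smul_mul, Matrix.mul_smul, add_mul, mul_add, one_mul, mul_one, smul_add,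
      hVV]
    match_scalars
    · linear_combination α ^ 2 * Complex.I_sq
    · linear_combination hα
  have hinv : Invertible P := invertibleOfLeftInverse P (P.transpose * V N 1) hP
  have e := skewAdjointMatricesLieSubalgebraEquiv (V N 1) P hinv
  rw [hP] at e
  exact ⟨e⟩

theorem nonempty_lieV_equiv_sp (hN : Even N) :
    Nonempty (lieV N (-1) ≃ₗ⁅ℂ⁆ LieAlgebra.Symplectic.sp (Fin (N / 2)) ℂ) := by
  have hθ : (-1 : ℂ) = 1 ∨ ((-1 : ℂ) = -1 ∧ Even N) := Or.inr ⟨rfl, hN⟩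
  have hN2 : N / 2 + N / 2 = N := by obtain ⟨k, hk⟩ := hN; omega
  let r : Fin (N / 2) → Fin N := fun i => ⟨i, by omega⟩
  -- The reversed upper half comes first because `Matrix.J` has its `-1` in the upper right block,
  -- and the entries `-1` of `V` lie in rows of the upper half of the indices.
  let m : Fin (N / 2) ⊕ Fin (N / 2) → Fin N := Sum.elim (fun i => (r i).rev) r
  have hr : ∀ i j, r i = r j ↔ i = j := fun i j => by simp [r, Fin.ext_iff]
  have hrr : ∀ i j, r i ≠ (r j).rev := fun i j h => by
    simp only [r, Fin.ext_iff, Fin.val_rev] at h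
    omega
  have hm : Function.Bijective m := by
    rw [Fintype.bijective_iff_injective_and_card]
    refine ⟨?_, by simp [hN2]⟩
    rintro (i | i) (j | j) h
    · simpa [m, hr] using h
    · exact (hrr j i h.symm).elim
    · exact (hrr i j h).elim
    · simpa [m, hr] using h
  let e : Fin N ≃ Fin (N / 2) ⊕ Fin (N / 2) := (Equiv.ofBijective m hm).symm
  have hJ : Matrix.reindexAlgEquiv ℂ ℂ e (V N (-1)) = Matrix.J (Fin (N / 2)) ℂ := by
    have hlow : ∀ i, antidiagEntry N (-1) (r i) = 1 := fun i => if_pos (by simp [r]; omega)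
    have key : ∀ x y, Matrix.reindexAlgEquiv ℂ ℂ e (V N (-1)) x y = V N (-1) (m x) (m y) :=
      fun x y => by simp [e]
    ext x y
    rw [key, V_apply]
    rcases x with i | i <;> rcases y with j | j
    · rw [if_neg]
      · simp [Matrix.J]
      · simpa [m] using (hrr i j).symm
    · simp [m, Matrix.J, hr, antidiagEntry_rev hθ, hlow, Matrix.one_apply, eq_comm (a := j)]
      split_ifs <;> simp
    · simp [m, Matrix.J, hr, hlow, Matrix.one_apply, eq_comm (a := j)]
    · rw [if_neg]
      · simp [Matrix.J]
      · exact hrr j i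
  have E := skewAdjointMatricesLieSubalgebraEquivTranspose (V N (-1))
    (Matrix.reindexAlgEquiv ℂ ℂ e) (fun A => by simp)
  rw [hJ] at E
  exact ⟨E⟩

end Classical

end SNPChain

theorem mainTheorem7 (N L : ℕ) (hN : 1 ≤ N) (hL : 1 ≤ L) (θ₀ : ℂ)
    (hθ : θ₀ = 1 ∨ (θ₀ = -1 ∧ Even N)) :
    -- the `S_{0i}` give the subleading term of the monodromy matrix
    (∀ f g : Fin (2 * L + 1) → Fin N,
      (fun lam : ℂ => (lam ^ (4 * L))⁻¹ * SNPChain.monodromy N L θ₀ 1 lam f g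
          - (1 : SNPChain.Op (2 * L + 1) N) f g
          - Complex.I / lam * SNPChain.Stot N L θ₀ f g)
        =O[Bornology.cobounded ℂ] (fun lam : ℂ => (lam ^ 2)⁻¹)) ∧
    -- symmetry of the transfer matrix
    (∀ lam : ℂ,
      ⁅SNPChain.extend₀ (SNPChain.transfer N L θ₀ 1 1 lam), SNPChain.Stot N L θ₀⁆ = 0) ∧
    (∀ (lam : ℂ) (a b : Fin N),
      ⁅SNPChain.transfer N L θ₀ 1 1 lam, SNPChain.gen N L θ₀ a b⁆ = 0) ∧
    -- commutation and symmetry relations of the generators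
    (∀ a b c d : Fin N,
      ⁅SNPChain.gen N L θ₀ a b, SNPChain.gen N L θ₀ c d⁆ =
        (if a = d then SNPChain.gen N L θ₀ c b else 0)
        - (if c = b then SNPChain.gen N L θ₀ a d else 0)
        - (SNPChain.antidiagEntry N θ₀ c * SNPChain.antidiagEntry N θ₀ d) •
          ((if a = c.rev then SNPChain.gen N L θ₀ d.rev b else 0)
            - (if b = d.rev then SNPChain.gen N L θ₀ a c.rev else 0))) ∧
    (∀ a b : Fin N,
      SNPChain.gen N L θ₀ a b
        + (SNPChain.antidiagEntry N θ₀ a * SNPChain.antidiagEntry N θ₀ b) •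
          SNPChain.gen N L θ₀ b.rev a.rev =
        if a = b then (2 * L * N : ℂ) • (1 : SNPChain.Op (2 * L) N) else 0) ∧
    -- up to a central shift, the generators realise the Lie algebra of `V`, faithfully
    (∃ φ : SNPChain.lieV N θ₀ →ₗ⁅ℂ⁆ SNPChain.Op (2 * L) N,
      Function.Injective φ ∧
      (∀ X : SNPChain.lieV N θ₀, φ X = ∑ j : Fin (2 * L),
        SNPChain.onSite j (X : Matrix (Fin N) (Fin N) ℂ)) ∧
      ∃ F : Fin N → Fin N → SNPChain.lieV N θ₀,
        (∀ a b : Fin N, (F a b : Matrix (Fin N) (Fin N) ℂ) =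
          Matrix.single b a 1 - SNPChain.transp N θ₀ (Matrix.single b a 1)) ∧
        Submodule.span ℂ (Set.range fun p : Fin N × Fin N => F p.1 p.2) = ⊤ ∧
        ∀ a b : Fin N, SNPChain.gen N L θ₀ a b =
          φ (F a b) + if a = b then (L * N : ℂ) • (1 : SNPChain.Op (2 * L) N) else 0) ∧
    -- which is `so(N)` or `sp(N)`
    (θ₀ = 1 → Nonempty (SNPChain.lieV N θ₀ ≃ₗ⁅ℂ⁆ LieAlgebra.Orthogonal.so (Fin N) ℂ)) ∧
    (θ₀ = -1 → Nonempty (SNPChain.lieV N θ₀ ≃ₗ⁅ℂ⁆ LieAlgebra.Symplectic.sp (Fin (N / 2)) ℂ)) := by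
  have hn : 2 * L ≠ 0 := by omega
  refine ⟨SNPChain.monodromy_isBigO hθ, fun lam =>
    SNPChain.lie_extend₀_eq_zero (SNPChain.lie_transfer_gen hθ lam),
    SNPChain.lie_transfer_gen hθ, SNPChain.lie_gen hθ, SNPChain.gen_add_gen_rev hθ,
    ⟨SNPChain.diagonalLieHom (2 * L) N θ₀, ?_, fun X => SNPChain.diagonal_apply _,
      SNPChain.generator hθ, fun _ _ => rfl, SNPChain.span_generator hθ,
      SNPChain.gen_eq_diagonal hθ⟩, ?_, ?_⟩
  · exact (SNPChain.diagonal_injective hn).comp Subtype.val_injective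
  · rintro rfl
    exact SNPChain.nonempty_lieV_equiv_so
  · rintro rfl
    rcases hθ with h | h
    · norm_num at h
    · exact SNPChain.nonempty_lieV_equiv_sp h.2
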